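/- Let $X$ and $Y$ be real Banach spaces, and let $V\subseteq X$ and $W\subseteq Y$ be countable dense subsets. A simple graph $G$ whose vertex set $V$ is a countable set of points of a normed space is called a *geometric $1$-graph* if 1. (threshold $1$) $\|u-v\|<1$ for every edge $uv$ of $G$; and 2. (geometrically existentially closed) for every $0<\delta'<1$, every $x\in V$, and all disjoint finite sets $A,B\subseteq V$ with $\|u-x\|<1$ for all $u\in A\cup B$, there is a vertex $z\in V\setminus(A\cup B\cup\{x\})$ such that $z$ is adjacent to every vertex of $A$ and to no vertex of $B$, $\|u-z\|<1$ for all $u\in A\cup B$, and $\|x-z\|<\delta'$. Let $G$ and $H$ be geometric $1$-graphs with vertex sets $V$ and $W$ respectively. If $G$ and $H$ are isomorphic as graphs, then there is a surjective linear isometry from $X$ onto $Y$; that is, $X$ and $Y$ are isometrically isomorphic as Banach spaces. -/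

import Mathlib

/-- A vertex `z` is correctly joined to `A` and `B`: it is adjacent to every vertex of `A`
and to no vertex of `B`. -/
def CorrectlyJoined {α : Type*} (G : SimpleGraph α) (z : α) (A B : Set α) : Prop :=
  (∀ a ∈ A, G.Adj z a) ∧ ∀ b ∈ B, ¬ G.Adj z b

/-- A graph whose vertex set is a set `V` of points of a normed space is geometrically
existentially closed at level `δ`. -/
def IsGEC {X : Type*} [NormedAddCommGroup X] {V : Set X} (δ : ℝ) (G : SimpleGraph V) : Prop :=
  ∀ δ' : ℝ, 0 < δ' → δ' < δ → ∀ x : V, ∀ A B : Set V,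
    A.Finite → B.Finite → Disjoint A B → (∀ u ∈ A ∪ B, ‖(u : X) - x‖ < δ) →
      ∃ z : V, z ∉ A ∪ B ∪ {x} ∧ CorrectlyJoined G z A B ∧
        (∀ u ∈ A ∪ B, ‖(u : X) - z‖ < δ) ∧ ‖(x : X) - z‖ < δ'

/-- A graph on a set of points of a normed space has threshold `δ`: adjacent vertices are at
distance less than `δ`. -/
def HasThreshold {X : Type*} [NormedAddCommGroup X] {V : Set X} (δ : ℝ)
    (G : SimpleGraph V) : Prop :=
  ∀ u v : V, G.Adj u v → ‖(u : X) - v‖ < δ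

/-- A geometric `δ`-graph: a countable graph on points of a normed space that is geometrically
existentially closed at level `δ` and has threshold `δ`. -/
structure IsGeometricGraph {X : Type*} [NormedAddCommGroup X] {V : Set X} (δ : ℝ)
    (G : SimpleGraph V) : Prop where
  countable : V.Countable
  gec : IsGEC δ G
  threshold : HasThreshold δ G

/-! Edges are shorter than 1, and existential closure lets short jumps between dense vertices be
realised by edges, up to small perturbation. So an isomorphism and its inverse increase distances by
at most 3 (`norm_hom_sub_le`), and rounding to the dense sets gives a coarse isometry `F` from X to
Y.

A quantitative Mazur–Ulam argument linearises `F`. Twisting a self-map that almost fixes two points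
by the reflection exchanging them roughly doubles the displacement of their midpoint, which is
bounded a priori. Hence midpoints are preserved up to sublinear error (`norm_map_midpoint_sub_le`),
and `8⁻ⁿ F(8ⁿ x)` converges. The limits of `F` and its coarse inverse are nonexpansive and mutually
inverse, so Mazur–Ulam applies. -/

open Filter Topology

/-- Two maps that are inverse to each other up to an error `ε` and increase distances by at most
`ε`. -/
structure IsCoarseIsometryPair {X Y : Type*} [NormedAddCommGroup X] [NormedAddCommGroup Y]
    (F : X → Y) (K : Y → X) (ε : ℝ) : Prop where
  map_le : ∀ x y, ‖F x - F y‖ ≤ ‖x - y‖ + ε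
  inv_le : ∀ x y, ‖K x - K y‖ ≤ ‖x - y‖ + ε
  right_inv : ∀ y, ‖F (K y) - y‖ ≤ ε
  left_inv : ∀ x, ‖K (F x) - x‖ ≤ ε

namespace IsCoarseIsometryPair

/-! ### Twisting coarse isometries by reflections -/

section NormedGroup

variable {X Y : Type*} [NormedAddCommGroup X] [NormedAddCommGroup Y]
  {F : X → Y} {K : Y → X} {ε : ℝ}

theorem symm (h : IsCoarseIsometryPair F K ε) : IsCoarseIsometryPair K F ε :=
  ⟨h.inv_le, h.map_le, h.left_inv, h.right_inv⟩

theorem nonneg (h : IsCoarseIsometryPair F K ε) : 0 ≤ ε :=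
  (norm_nonneg _).trans (h.left_inv 0)

theorem le_map (h : IsCoarseIsometryPair F K ε) (x y : X) :
    ‖x - y‖ ≤ ‖F x - F y‖ + 3 * ε := by
  have h1 := h.inv_le (F x) (F y)
  have h2 := h.left_inv x
  have h3 := h.left_inv y
  have h4 : ‖x - y‖ ≤ ‖K (F x) - K (F y)‖ + ‖K (F x) - x‖ + ‖K (F y) - y‖ := by
    rw [show x - y = (K (F x) - K (F y)) - (K (F x) - x) + (K (F y) - y) by abel]
    exact (norm_add_le _ _).trans (by gcongr; exact norm_sub_le _ _)
  linarith

theorem norm_inv_sub_le (h : IsCoarseIsometryPair F K ε) (y : Y) (x : X) :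
    ‖K y - x‖ ≤ ‖y - F x‖ + 2 * ε := by
  have h1 := h.inv_le y (F x)
  have h2 := h.left_inv x
  have h3 := norm_sub_le_norm_sub_add_norm_sub (K y) (K (F x)) x
  linarith

/-- Conjugating the reflection `y ↦ d - y` by a coarse isometry and composing with the reflection
`x ↦ c - x`. -/
theorem twist (h : IsCoarseIsometryPair F K ε) (c : X) (d : Y) :
    IsCoarseIsometryPair (fun x => c - K (d - F x)) (fun x => K (d - F (c - x))) (3 * ε) where
  map_le x y := by
    have h1 := h.inv_le (d - F y) (d - F x)
    have h2 := h.map_le x y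
    rw [sub_sub_sub_cancel_left] at h1 ⊢
    linarith [h.nonneg]
  inv_le x y := by
    have h1 := h.inv_le (d - F (c - x)) (d - F (c - y))
    have h2 := h.map_le (c - y) (c - x)
    rw [sub_sub_sub_cancel_left] at h1 h2
    linarith [h.nonneg]
  right_inv x := by
    have h1 := h.norm_inv_sub_le (d - F (K (d - F (c - x)))) (c - x)
    have h2 := h.right_inv (d - F (c - x))
    rw [norm_sub_rev] at h2
    rw [sub_right_comm d] at h1
    rw [sub_right_comm, norm_sub_rev]
    linarith
  left_inv x := by
    have h1 := h.norm_inv_sub_le (d - F (K (d - F x))) x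
    have h2 := h.right_inv (d - F x)
    rw [norm_sub_rev] at h2
    rw [sub_right_comm] at h1
    rw [sub_sub_cancel]
    linarith

theorem norm_sub_two_le (h : IsCoarseIsometryPair F K ε) (z : X) (d : Y) :
    ‖d - (F z + F z)‖ ≤ ‖(z + z - K (d - F z)) - z‖ + 4 * ε := by
  have h1 := h.symm.le_map (d - F z) (F z)
  have h2 := h.left_inv z
  have h3 := norm_sub_le_norm_sub_add_norm_sub (K (d - F z)) z (K (F z))
  rw [norm_sub_rev z] at h3
  rw [show z + z - K (d - F z) - z = -(K (d - F z) - z) by abel, norm_neg]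
  rw [sub_sub] at h1
  linarith

/-- The twist by reflections exchanging `a`, `b` almost fixes `a`. -/
theorem twist_almost_fixes (h : IsCoarseIsometryPair F K ε) (a b : X) (d : Y) :
    ‖(a + b - K (d - F a)) - a‖ ≤ ‖d - (F a + F b)‖ + 2 * ε := by
  have h1 := h.norm_inv_sub_le (d - F a) b
  rw [show a + b - K (d - F a) - a = -(K (d - F a) - b) by abel, norm_neg]
  rwa [sub_sub] at h1

end NormedGroup

/-! ### Approximate midpoints and linearisation at infinity -/

section NormedSpace

variable {X Y : Type*} [NormedAddCommGroup X] [NormedSpace ℝ X] [NormedAddCommGroup Y]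
  [NormedSpace ℝ Y] {F : X → Y} {K : Y → X} {ε : ℝ}

/-- A coarse self-isometry that almost fixes two points moves their midpoint only a little. -/
theorem norm_map_midpoint_sub_le {g k : X → X} (n : ℕ) (h : IsCoarseIsometryPair g k ε)
    {a b z : X} (hz : a + b = z + z) (ha : ‖g a - a‖ ≤ ε) (hb : ‖g b - b‖ ≤ ε)
    {r : ℝ} (hr : ‖z - a‖ ≤ r) :
    ‖g z - z‖ ≤ 2 * r / 2 ^ n + 2 * 4 ^ n * ε := by
  induction n generalizing g k ε with
  | zero =>
    have h1 := h.map_le z a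
    have h2 := norm_sub_le_norm_sub_add_norm_sub (g z) (g a) z
    have h3 := norm_sub_le_norm_sub_add_norm_sub (g a) a z
    rw [norm_sub_rev a z] at h3
    simp only [pow_zero]
    linarith
  | succ n ih =>
    have hε := h.nonneg
    have hfix : ‖a + b - (g a + g b)‖ ≤ 2 * ε := by
      rw [show a + b - (g a + g b) = -((g a - a) + (g b - b)) by abel, norm_neg]
      linarith [norm_add_le (g a - a) (g b - b)]
    have h0 := h.twist (a + b) (a + b)
    -- The twist has error `3 * ε`; `4 * ε` also covers its displacement of `a` and `b`, at most `2
    -- * ε + 2 * ε`.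
    have h1 : IsCoarseIsometryPair (fun x => a + b - k (a + b - g x))
        (fun x => k (a + b - g (a + b - x))) (4 * ε) :=
      ⟨fun x y => (h0.map_le x y).trans (by linarith),
        fun x y => (h0.inv_le x y).trans (by linarith),
        fun x => (h0.right_inv x).trans (by linarith),
        fun x => (h0.left_inv x).trans (by linarith)⟩
    have h2 := ih h1 ((h.twist_almost_fixes a b (a + b)).trans (by linarith))
      (by
        have := h.twist_almost_fixes b a (a + b)
        rw [add_comm b a, add_comm (g b)] at this
        exact this.trans (by linarith))
    -- Doubling: the twist moves `z` at least twice as far as `g` does, less `4 * ε`.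
    have h3 := h.norm_sub_two_le z (z + z)
    simp only [hz] at h2
    have h4 : ‖z + z - (g z + g z)‖ = 2 * ‖g z - z‖ := by
      rw [show z + z - (g z + g z) = -((2 : ℝ) • (g z - z)) by rw [two_smul]; abel, norm_neg, norm_smul]
      norm_num
    have h5 : (1 : ℝ) ≤ 4 ^ n := one_le_pow₀ (by norm_num)
    have h6 : 2 * r / 2 ^ (n + 1) = 2 * r / 2 ^ n / 2 := by rw [pow_succ, div_div]
    rw [h6, pow_succ]
    nlinarith [mul_le_mul_of_nonneg_right h5 hε]

/-- Here `x` is the midpoint of `0` and `2x`. Iterating `n` times at radius `8 ^ n * R` balances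
both errors at order `4 ^ n`, which is sublinear in the radius. -/
theorem norm_map_two_smul_sub_le (h : IsCoarseIsometryPair F K ε) (n : ℕ) (x : X) {R : ℝ}
    (hx : ‖x‖ ≤ 8 ^ n * R) :
    ‖F ((2 : ℝ) • x) - (2 : ℝ) • F x‖ ≤ 4 ^ n * (2 * R + 10 * ε + ‖F 0‖) := by
  have hε := h.nonneg
  have h0 := h.twist (0 + (x + x)) (F 0 + F (x + x))
  have ha := h.twist_almost_fixes 0 (x + x) (F 0 + F (x + x))
  have hb := h.twist_almost_fixes (x + x) 0 (F 0 + F (x + x))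
  rw [add_comm (x + x) 0, add_comm (F (x + x)) (F 0)] at hb
  rw [sub_self, norm_zero] at ha hb
  have h1 := h0.norm_map_midpoint_sub_le n (a := 0) (b := x + x) (z := x) (by simp)
    (ha.trans (by linarith)) (hb.trans (by linarith)) (r := 8 ^ n * R) (by simpa using hx)
  have h2 := h.norm_sub_two_le x (F 0 + F (x + x))
  rw [zero_add] at h1
  have h3 : 2 * (8 ^ n * R) / 2 ^ n = 4 ^ n * (2 * R) := by
    rw [show (8 : ℝ) = 4 * 2 by norm_num, mul_pow]
    field_simp
  have h4 : ‖F ((2 : ℝ) • x) - (2 : ℝ) • F x‖ ≤ ‖F 0 + F (x + x) - (F x + F x)‖ + ‖F 0‖ := by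
    rw [two_smul, two_smul,
      show F (x + x) - (F x + F x) = F 0 + F (x + x) - (F x + F x) - F 0 by abel]
    exact norm_sub_le _ _
  have h5 : (1 : ℝ) ≤ 4 ^ n := one_le_pow₀ (by norm_num)
  rw [h3] at h1
  nlinarith [mul_le_mul_of_nonneg_right h5 hε, mul_le_mul_of_nonneg_right h5 (norm_nonneg (F 0))]

theorem norm_map_eight_smul_sub_le (h : IsCoarseIsometryPair F K ε) (n : ℕ) (x : X) {R : ℝ}
    (hx : ‖x‖ ≤ 8 ^ n * R) :
    ‖F ((8 : ℝ) • x) - (8 : ℝ) • F x‖ ≤ 7 * (4 ^ n * (8 * R + 10 * ε + ‖F 0‖)) := by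
  have hR : 0 ≤ 8 ^ n * R := (norm_nonneg x).trans hx
  have hs (t : ℝ) (ht : 0 ≤ t) (ht' : t ≤ 4) : ‖t • x‖ ≤ 8 ^ n * (4 * R) := by
    rw [norm_smul, Real.norm_of_nonneg ht]
    nlinarith [norm_nonneg x]
  have h1 := h.norm_map_two_smul_sub_le n ((1 : ℝ) • x) (hs 1 (by norm_num) (by norm_num))
  have h2 := h.norm_map_two_smul_sub_le n ((2 : ℝ) • x) (hs 2 (by norm_num) (by norm_num))
  have h3 := h.norm_map_two_smul_sub_le n ((4 : ℝ) • x) (hs 4 (by norm_num) le_rfl)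
  rw [smul_smul] at h1 h2 h3
  norm_num at h1 h2 h3
  have h4 : F ((8 : ℝ) • x) - (8 : ℝ) • F x = (F ((8 : ℝ) • x) - (2 : ℝ) • F ((4 : ℝ) • x)) +
      (2 : ℝ) • (F ((4 : ℝ) • x) - (2 : ℝ) • F ((2 : ℝ) • x)) +
      (4 : ℝ) • (F ((2 : ℝ) • x) - (2 : ℝ) • F x) := by
    module
  rw [h4]
  refine norm_add₃_le.trans ?_
  rw [norm_smul, norm_smul]
  norm_num
  linarith

theorem exists_tendsto [CompleteSpace Y] (h : IsCoarseIsometryPair F K ε) (x : X) :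
    ∃ y, Tendsto (fun n : ℕ => ((8 : ℝ) ^ n)⁻¹ • F ((8 : ℝ) ^ n • x)) atTop (𝓝 y) := by
  refine cauchySeq_tendsto_of_complete
    (cauchySeq_of_le_geometric_two (C := 7 / 4 * (8 * ‖x‖ + 10 * ε + ‖F 0‖)) fun n => ?_)
  have h1 := h.norm_map_eight_smul_sub_le n ((8 : ℝ) ^ n • x) (R := ‖x‖) (by simp [norm_smul])
  rw [smul_smul, ← pow_succ'] at h1
  have h2 : ((8 : ℝ) ^ (n + 1))⁻¹ • F ((8 : ℝ) ^ (n + 1) • x) -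
      ((8 : ℝ) ^ n)⁻¹ • F ((8 : ℝ) ^ n • x) = ((8 : ℝ) ^ (n + 1))⁻¹ •
        (F ((8 : ℝ) ^ (n + 1) • x) - (8 : ℝ) • F ((8 : ℝ) ^ n • x)) := by
    rw [smul_sub, smul_smul, pow_succ, mul_inv, mul_assoc, inv_mul_cancel₀ (by norm_num), mul_one]
  rw [dist_comm, dist_eq_norm, h2, norm_smul, Real.norm_of_nonneg (by positivity)]
  -- Increments are of order `4 ^ n / 8 ^ n`, hence geometric with ratio `1/2`.
  refine (mul_le_mul_of_nonneg_left h1 (by positivity)).trans (le_of_eq ?_)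
  rw [pow_succ, show (8 : ℝ) ^ n = 4 ^ n * 2 ^ n by rw [← mul_pow]; norm_num]
  field_simp
  ring

/-- The linearisation at infinity of a coarse isometry between Banach spaces. -/
noncomputable def limitMap [CompleteSpace Y] (h : IsCoarseIsometryPair F K ε) (x : X) : Y :=
  (h.exists_tendsto x).choose

theorem tendsto_limitMap [CompleteSpace Y] (h : IsCoarseIsometryPair F K ε) (x : X) :
    Tendsto (fun n : ℕ => ((8 : ℝ) ^ n)⁻¹ • F ((8 : ℝ) ^ n • x)) atTop (𝓝 (h.limitMap x)) :=
  (h.exists_tendsto x).choose_spec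

theorem tendsto_inv_eight_pow_mul (C : ℝ) :
    Tendsto (fun n : ℕ => ((8 : ℝ) ^ n)⁻¹ * C) atTop (𝓝 0) := by
  simpa using ((tendsto_pow_atTop_atTop_of_one_lt (by norm_num : (1 : ℝ) < 8)).inv_tendsto_atTop
    ).mul_const C

theorem norm_rescaled_sub_le (h : IsCoarseIsometryPair F K ε) {t : ℝ} (ht : 0 < t) (x y : X) :
    ‖t⁻¹ • F (t • x) - t⁻¹ • F (t • y)‖ ≤ ‖x - y‖ + t⁻¹ * ε := by
  have h1 := h.map_le (t • x) (t • y)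
  rw [← smul_sub, norm_smul, Real.norm_of_nonneg ht.le] at h1
  rw [← smul_sub, norm_smul, Real.norm_of_nonneg (by positivity)]
  refine (mul_le_mul_of_nonneg_left h1 (by positivity)).trans (le_of_eq ?_)
  field_simp

theorem norm_limitMap_sub_le [CompleteSpace Y] (h : IsCoarseIsometryPair F K ε) (x y : X) :
    ‖h.limitMap x - h.limitMap y‖ ≤ ‖x - y‖ := by
  have h1 := (tendsto_inv_eight_pow_mul ε).const_add ‖x - y‖
  rw [add_zero] at h1
  exact le_of_tendsto_of_tendsto' ((h.tendsto_limitMap x).sub (h.tendsto_limitMap y)).norm h1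
    fun n => h.norm_rescaled_sub_le (by positivity) x y

theorem limitMap_limitMap [CompleteSpace X] [CompleteSpace Y] (h : IsCoarseIsometryPair F K ε)
    (y : Y) : h.limitMap (h.symm.limitMap y) = y := by
  refine tendsto_nhds_unique (h.tendsto_limitMap _) (tendsto_iff_norm_sub_tendsto_zero.2 ?_)
  have h1 := (tendsto_iff_norm_sub_tendsto_zero.1 (h.symm.tendsto_limitMap y)).add
    (tendsto_inv_eight_pow_mul (2 * ε))
  rw [add_zero] at h1
  refine squeeze_zero (fun _ => norm_nonneg _) (fun n => ?_) h1
  have ht : (0 : ℝ) < 8 ^ n := by positivity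
  -- Rescaled `F` is nearly nonexpansive, so the limit point may be replaced by its approximant.
  have h2 := h.norm_rescaled_sub_le ht (h.symm.limitMap y) (((8 : ℝ) ^ n)⁻¹ • K ((8 : ℝ) ^ n • y))
  rw [smul_inv_smul₀ ht.ne', norm_sub_rev (h.symm.limitMap y)] at h2
  have h3 := mul_le_mul_of_nonneg_left (h.right_inv ((8 : ℝ) ^ n • y)) (inv_nonneg.2 ht.le)
  rw [← Real.norm_of_nonneg (inv_nonneg.2 ht.le), ← norm_smul, smul_sub, inv_smul_smul₀ ht.ne',
    Real.norm_of_nonneg (inv_nonneg.2 ht.le)] at h3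
  have h4 := norm_sub_le_norm_sub_add_norm_sub (((8 : ℝ) ^ n)⁻¹ • F ((8 : ℝ) ^ n • h.symm.limitMap y))
    (((8 : ℝ) ^ n)⁻¹ • F (K ((8 : ℝ) ^ n • y))) y
  linarith

theorem limitMap_zero [CompleteSpace Y] (h : IsCoarseIsometryPair F K ε) : h.limitMap 0 = 0 := by
  refine tendsto_nhds_unique (h.tendsto_limitMap 0) (tendsto_zero_iff_norm_tendsto_zero.2 ?_)
  simpa [norm_smul] using tendsto_inv_eight_pow_mul ‖F 0‖

/-- Coarsely isometric Banach spaces are linearly isometric. -/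
theorem nonempty_linearIsometryEquiv [CompleteSpace X] [CompleteSpace Y]
    (h : IsCoarseIsometryPair F K ε) : Nonempty (X ≃ₗᵢ[ℝ] Y) := by
  have hiso : Isometry h.limitMap := Isometry.of_dist_eq fun x y => by
    rw [dist_eq_norm, dist_eq_norm]
    refine le_antisymm (h.norm_limitMap_sub_le x y) ?_
    have h1 := h.symm.norm_limitMap_sub_le (h.limitMap x) (h.limitMap y)
    rwa [h.symm.limitMap_limitMap, h.symm.limitMap_limitMap] at h1
  exact ⟨(IsometryEquiv.mk' h.limitMap h.symm.limitMap h.limitMap_limitMap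
    hiso).toRealLinearIsometryEquivOfMapZero h.limitMap_zero⟩

end NormedSpace

end IsCoarseIsometryPair

/-- In a real normed space, two points at distance less than `r + s` are joined through a point of
any given dense set, with steps shorter than `r` and `s`. -/
theorem Dense.exists_norm_sub_lt_and_norm_sub_lt {X : Type*} [NormedAddCommGroup X]
    [NormedSpace ℝ X] {V : Set X} (hV : Dense V) {x y : X} {r s : ℝ} (hr : 0 < r) (hs : 0 < s)
    (hxy : ‖x - y‖ < r + s) : ∃ v : V, ‖x - v‖ < r ∧ ‖(v : X) - y‖ < s := by
  have hne : (Metric.ball x r ∩ Metric.ball y s).Nonempty := by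
    rw [← dist_eq_norm] at hxy
    obtain ⟨z, hz⟩ := exists_dist_lt_lt hr hs (by rwa [add_comm s])
    exact ⟨z, by simpa [dist_comm] using hz.1, hz.2⟩
  obtain ⟨v, hv, hvV⟩ := hV.inter_open_nonempty _ (Metric.isOpen_ball.inter Metric.isOpen_ball) hne
  refine ⟨⟨v, hvV⟩, ?_, ?_⟩
  · rw [norm_sub_rev, ← dist_eq_norm]
    exact hv.1
  · rw [← dist_eq_norm]
    exact hv.2

/-! ### Edge paths in geometric graphs -/

section Graph

variable {X Y : Type*} [NormedAddCommGroup X] [NormedAddCommGroup Y]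
  {V : Set X} {W : Set Y} {G : SimpleGraph V} {H : SimpleGraph W}

theorem IsGEC.exists_adj_norm_sub_lt (hG : IsGEC 1 G) {A : Set V} (hA : A.Finite) (x : V)
    (hAx : ∀ u ∈ A, ‖(u : X) - x‖ < 1) {δ : ℝ} (hδ : 0 < δ) :
    ∃ z : V, (∀ a ∈ A, G.Adj z a) ∧ ‖(z : X) - x‖ < δ := by
  obtain ⟨z, -, hz, -, hzx⟩ := hG (min δ (1 / 2)) (by positivity)
    ((min_le_right _ _).trans_lt (by norm_num)) x A ∅ hA Set.finite_empty (by simp)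
    (by simpa using hAx)
  refine ⟨z, hz.1, ?_⟩
  rw [norm_sub_rev]
  exact hzx.trans_le (min_le_left _ _)

/-- A path of `k + 1` edges from `u` ends at `w`, close to `v` but not necessarily `v`, since
closure prescribes adjacencies only for some nearby vertex. -/
theorem exists_norm_sub_lt_of_hom [NormedSpace ℝ X] (hV : Dense V) (hG : IsGEC 1 G) (hH : HasThreshold 1 H)
    (f : G →g H) (k : ℕ) (u v : V) (huv : ‖(u : X) - v‖ < k + 1) {δ : ℝ} (hδ : 0 < δ) :
    ∃ w : V, ‖(w : X) - v‖ < δ ∧ ‖(f u : Y) - f w‖ < k + 1 := by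
  induction k generalizing v δ with
  | zero =>
    obtain ⟨z, hz, hzv⟩ := hG.exists_adj_norm_sub_lt (Set.finite_singleton u) v
      (by simpa using huv) hδ
    refine ⟨z, hzv, ?_⟩
    simpa using hH _ _ (f.map_adj (hz u rfl).symm)
  | succ k ih =>
    push_cast at huv
    obtain ⟨v', huv', hv'⟩ := hV.exists_norm_sub_lt_and_norm_sub_lt (by positivity) one_pos huv
    -- The slack in `hv'` keeps `w` within 1 of `v`.
    obtain ⟨w, hw, hfw⟩ := ih v' huv' (sub_pos.2 hv')
    have hwv : ‖(w : X) - v‖ < 1 := by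
      have := norm_sub_le_norm_sub_add_norm_sub (w : X) v' v
      linarith
    obtain ⟨z, hz, hzv⟩ := hG.exists_adj_norm_sub_lt (Set.finite_singleton w) v
      (by simpa using hwv) hδ
    refine ⟨z, hzv, ?_⟩
    have h1 := hH _ _ (f.map_adj (hz w rfl).symm)
    have h2 := norm_sub_le_norm_sub_add_norm_sub (f u : Y) (f w) (f z)
    push_cast
    linarith

/-- A homomorphism between geometric graphs increases distances by at most `3`. -/
theorem norm_hom_sub_le [NormedSpace ℝ X] (hV : Dense V) (hG : IsGEC 1 G) (hH : HasThreshold 1 H)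
    (f : G →g H) (u v : V) : ‖(f u : Y) - f v‖ ≤ ‖(u : X) - v‖ + 3 := by
  obtain ⟨w, hw, hfw⟩ := exists_norm_sub_lt_of_hom hV hG hH f ⌊‖(u : X) - v‖⌋₊ u v
    (Nat.lt_floor_add_one _) one_pos
  -- A common neighbour of `w` and `v` costs two more edges; the floor accounts for the third unit.
  obtain ⟨z, hz, -⟩ := hG.exists_adj_norm_sub_lt (Set.toFinite {w, v}) v
    (by simpa using hw) one_pos
  have h1 := hH _ _ (f.map_adj (hz w (by simp)).symm)
  have h2 := hH _ _ (f.map_adj (hz v (by simp)))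
  have h3 := norm_sub_le_norm_sub_add_norm_sub (f u : Y) (f w) (f v)
  have h4 := norm_sub_le_norm_sub_add_norm_sub (f w : Y) (f z) (f v)
  have h5 := Nat.floor_le (norm_nonneg ((u : X) - v))
  linarith

end Graph

theorem IsCoarseIsometryPair.exists_of_dense {X Y : Type*} [NormedAddCommGroup X]
    [NormedAddCommGroup Y] {V : Set X} {W : Set Y} (hV : Dense V) (hW : Dense W) (f : V ≃ W)
    {C : ℝ} (hf : ∀ u v, ‖(f u : Y) - f v‖ ≤ ‖(u : X) - v‖ + C)
    (hf' : ∀ u v, ‖(f.symm u : X) - f.symm v‖ ≤ ‖(u : Y) - v‖ + C) :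
    ∃ (F : X → Y) (K : Y → X), IsCoarseIsometryPair F K (C + 2) := by
  have hp (x : X) : ∃ v : V, ‖(v : X) - x‖ < 1 := by
    obtain ⟨v, hv, hxv⟩ := hV.exists_dist_lt x one_pos
    exact ⟨⟨v, hv⟩, by rwa [norm_sub_rev, ← dist_eq_norm]⟩
  have hq (y : Y) : ∃ w : W, ‖(w : Y) - y‖ < 1 := by
    obtain ⟨v, hv, hxv⟩ := hW.exists_dist_lt y one_pos
    exact ⟨⟨v, hv⟩, by rwa [norm_sub_rev, ← dist_eq_norm]⟩
  choose p hp using hp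
  choose q hq using hq
  -- Two roundings, each by less than 1, give the extra 2.
  refine ⟨fun x => f (p x), fun y => f.symm (q y), fun x y => ?_, fun x y => ?_, fun y => ?_,
    fun x => ?_⟩
  · have h1 := hf (p x) (p y)
    have h2 := norm_sub_le_norm_sub_add_norm_sub (p x : X) x (p y)
    have h3 := norm_sub_le_norm_sub_add_norm_sub x y (p y : X)
    rw [norm_sub_rev y] at h3
    linarith [hp x, hp y]
  · have h1 := hf' (q x) (q y)
    have h2 := norm_sub_le_norm_sub_add_norm_sub (q x : Y) x (q y)
    have h3 := norm_sub_le_norm_sub_add_norm_sub x y (q y : Y)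
    rw [norm_sub_rev y] at h3
    linarith [hq x, hq y]
  · have h1 := hf (p (f.symm (q y))) (f.symm (q y))
    rw [f.apply_symm_apply] at h1
    have h2 := norm_sub_le_norm_sub_add_norm_sub (f (p (f.symm (q y))) : Y) (q y) y
    linarith [hp (f.symm (q y)), hq y]
  · have h1 := hf' (q (f (p x))) (f (p x))
    rw [f.symm_apply_apply] at h1
    have h2 := norm_sub_le_norm_sub_add_norm_sub (f.symm (q (f (p x))) : X) (p x) x
    linarith [hq (f (p x)), hp x]

theorem mainTheorem3 {X Y : Type*}
    [NormedAddCommGroup X] [NormedSpace ℝ X] [CompleteSpace X]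
    [NormedAddCommGroup Y] [NormedSpace ℝ Y] [CompleteSpace Y]
    (V : Set X) (W : Set Y)
    (hVc : V.Countable) (hVd : Dense V) (hWc : W.Countable) (hWd : Dense W)
    (G : SimpleGraph V) (H : SimpleGraph W)
    (hG : IsGeometricGraph 1 G) (hH : IsGeometricGraph 1 H)
    (hiso : Nonempty (G ≃g H)) :
    Nonempty (X ≃ₗᵢ[ℝ] Y) := by
  obtain ⟨f⟩ := hiso
  obtain ⟨F, K, h⟩ := IsCoarseIsometryPair.exists_of_dense hVd hWd f.toEquiv
    (norm_hom_sub_le hVd hG.gec hH.threshold f.toHom)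
    (norm_hom_sub_le hWd hH.gec hG.threshold f.symm.toHom)
  exact h.nonempty_linearIsometryEquiv
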